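/- Let $V=\bigoplus_{n\ge 0}V_n$ be a vertex operator algebra over $\mathbb{C}$ of CFT type ($V_0=\mathbb{C}\mathbf 1$), put $V_+=\bigoplus_{n\ge1}V_n$, and let $M=\bigoplus_{n\ge 0}M(n)$ be an admissible $V$-module. Write $Y_M(a,z)=\sum_n a_n z^{-n-1}$. Let $C_2(M)=\mathrm{span}\{a_{-2}v : a\in V, v\in M\}$, let $O(M)$ be the span of the elements $\mathrm{Res}_z\, Y_M(a,z)v\,(1+z)^{\mathrm{wt}\,a}/z^2$ ($a\in V$ homogeneous, $v\in M$), and let $A(V)=V/O(V)$ be Zhu's algebra and $A(M)=M/O(M)$ the $A(V)$-module with $a\ast v=\mathrm{Res}_z\,Y_M(a,z)v\,(1+z)^{\mathrm{wt}\,a}/z$. Filter them by letting $A(V)_n$ and $A(M)_n$ be the images of $\bigoplus_{i\le n}V_i$ and $\bigoplus_{i\le n}M(i)$, with $A(V)_{-1}=A(M)_{-1}=0$; then $\mathrm{gr}\,A(M)=\bigoplus_{n\ge 0}A(M)_n/A(M)_{n-1}$ is a module over the ring $\mathrm{gr}\,A(V)=\bigoplus_{n\ge 0}A(V)_n/A(V)_{n-1}$.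 Let $\psi:M/C_2(M)\to \mathrm{gr}\,A(M)$ be the well-defined linear map with $\psi(v+C_2(M))=\bar v\in A(M)_n/A(M)_{n-1}$ for $v\in M(n)$. A subset $W\subseteq M$ is said to strongly generate $M$ if $M$ is spanned by the elements $a^1_{-n_1}\cdots a^k_{-n_k}w$ with $k\ge 0$, $a^i\in V_+$ homogeneous, $n_i\ge 1$ and $w\in W$; $M$ is strongly finitely generated if it is strongly generated by a finite subset. (1) If $M$ is strongly generated by a subset $W\subseteq M$, then $\mathrm{gr}\,A(M)$ is generated as a $\mathrm{gr}\,A(V)$-module by $\psi(W/C_2(M))=\{\psi(w+C_2(M)) : w\in W\}$. (2) If $M$ is strongly finitely generated, then $\mathrm{gr}\,A(M)$ is a finitely generated $\mathrm{gr}\,A(V)$-module. -/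

import Mathlib

open scoped DirectSum

noncomputable section

/-! ### Associated graded ring and module of a filtration indexed by `ℕ` -/

namespace Filt

variable {k R M : Type*} [CommRing k] [Ring R] [Module k R]
  [AddCommGroup M] [Module k M] [Module R M]

/-- The shifted family `n ↦ F (n - 1)`, with the convention `F (-1) = 0`. -/
def prev (F : ℕ → Submodule k M) : ℕ → Submodule k M
  | 0 => ⊥
  | n + 1 => F n

theorem isFiltration {F : ℕ → Submodule k M} (hF : Monotone F) :
    IsFiltration F (prev F) where
  mono := hF
  is_le {i j} h := by
    cases j with
    | zero => omega
    | succ j => exact hF (by omega)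
  is_sup B j h := by
    cases j with
    | zero => exact bot_le
    | succ j => exact h j (by omega)

/-- The graded piece `F n / F (n - 1)`. -/
def Piece (F : ℕ → Submodule k M) (n : ℕ) : Type _ :=
  F n ⧸ (prev F n).submoduleOf (F n)

instance (F : ℕ → Submodule k M) (n : ℕ) : AddCommGroup (Piece F n) :=
  inferInstanceAs (AddCommGroup (F n ⧸ (prev F n).submoduleOf (F n)))

instance (F : ℕ → Submodule k M) (n : ℕ) : Module k (Piece F n) :=
  inferInstanceAs (Module k (F n ⧸ (prev F n).submoduleOf (F n)))

/-- The class in `F n / F (n - 1)` of an element of `F n`. -/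
def toPiece (F : ℕ → Submodule k M) (n : ℕ) : F n →ₗ[k] Piece F n :=
  ((prev F n).submoduleOf (F n)).mkQ

/-- The associated graded space `⨁ n, F n / F (n - 1)`. -/
abbrev Gr (F : ℕ → Submodule k M) : Type _ := ⨁ n, Piece F n

theorem mk_eq_mk (F : ℕ → Submodule k M) {i j : ℕ} (h : i = j) (x : F i) (y : F j)
    (hxy : (x : M) = y) :
    GradedMonoid.mk (A := Piece F) i (toPiece F i x)
      = GradedMonoid.mk (A := Piece F) j (toPiece F j y) := by
  subst h
  rw [Subtype.ext hxy]

theorem toPiece_eq (F : ℕ → Submodule k M) {i : ℕ} {x y : F i}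
    (h : (x : M) - y ∈ prev F i) : toPiece F i x = toPiece F i y :=
  (Submodule.Quotient.eq _).2 h

theorem smul_prev_left {F : ℕ → Submodule k R} {G : ℕ → Submodule k M}
    [SetLike.GradedSMul F G] {i j : ℕ} {x : R} {y : M} (hx : x ∈ prev F i) (hy : y ∈ G j) :
    x • y ∈ prev G (i + j) := by
  cases i with
  | zero => rw [(Submodule.mem_bot k).1 hx, zero_smul]; exact zero_mem _
  | succ i =>
    rw [show i + 1 + j = (i + j) + 1 by omega]
    exact SetLike.GradedSMul.smul_mem (A := F) (B := G) hx hy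

theorem smul_prev_right {F : ℕ → Submodule k R} {G : ℕ → Submodule k M}
    [SetLike.GradedSMul F G] {i j : ℕ} {x : R} {y : M} (hx : x ∈ F i) (hy : y ∈ prev G j) :
    x • y ∈ prev G (i + j) := by
  cases j with
  | zero => rw [(Submodule.mem_bot k).1 hy, smul_zero]; exact zero_mem _
  | succ j => exact SetLike.GradedSMul.smul_mem (A := F) (B := G) hx hy

/-- The action `F i / F (i-1) × G j / G (j-1) → G (i+j) / G (i+j-1)`, `(x̄, ȳ) ↦ (x y)‾`. -/
def pieceSMul (F : ℕ → Submodule k R) (G : ℕ → Submodule k M) [SetLike.GradedSMul F G]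
    (i j : ℕ) : Piece F i → Piece G j → Piece G (i + j) :=
  Quotient.map₂
    (fun x y => ⟨(x : R) • (y : M), SetLike.GradedSMul.smul_mem (A := F) (B := G) x.2 y.2⟩)
    (by
      intro x x' hx y y' hy
      have hx' : (x : R) - x' ∈ prev F i :=
        (Submodule.quotientRel_def ((prev F i).submoduleOf (F i))).1 hx
      have hy' : (y : M) - y' ∈ prev G j :=
        (Submodule.quotientRel_def ((prev G j).submoduleOf (G j))).1 hy
      refine (Submodule.quotientRel_def _).2 ?_
      change (x : R) • (y : M) - (x' : R) • (y' : M) ∈ prev G (i + j)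
      have e : (x : R) • (y : M) - (x' : R) • (y' : M)
          = ((x : R) - x') • (y : M) + (x' : R) • ((y : M) - y') := by
        rw [sub_smul, smul_sub]; abel
      rw [e]
      exact add_mem (smul_prev_left hx' y.2) (smul_prev_right x'.2 hy'))

theorem pieceSMul_mk (F : ℕ → Submodule k R) (G : ℕ → Submodule k M) [SetLike.GradedSMul F G]
    (i j : ℕ) (x : F i) (y : G j) :
    pieceSMul F G i j (toPiece F i x) (toPiece G j y) = toPiece G (i + j)
      ⟨(x : R) • (y : M), SetLike.GradedSMul.smul_mem (A := F) (B := G) x.2 y.2⟩ := rfl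

theorem gradedSMul_self (F : ℕ → Submodule k R) [SetLike.GradedMonoid F] :
    SetLike.GradedSMul F F :=
  ⟨fun _ _ _ _ hx hy => SetLike.mul_mem_graded hx hy⟩

/-- The products `x̄ ȳ = (x y)‾` on the pieces of a filtered ring, with unit `1̄`. -/
instance pieceGMonoid (F : ℕ → Submodule k R) [IsRingFiltration F (prev F)] :
    GradedMonoid.GMonoid (Piece F) :=
  haveI := gradedSMul_self F
  letI : GradedMonoid.GMul (Piece F) := ⟨fun {i j} => pieceSMul F F i j⟩
  letI : GradedMonoid.GOne (Piece F) := ⟨toPiece F 0 ⟨1, SetLike.one_mem_graded F⟩⟩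
  { one_mul := by
      rintro ⟨i, ⟨x⟩⟩
      exact mk_eq_mk F (zero_add i) _ _ (one_mul (x : R))
    mul_one := by
      rintro ⟨i, ⟨x⟩⟩
      exact mk_eq_mk F (add_zero i) _ _ (mul_one (x : R))
    mul_assoc := by
      rintro ⟨i, ⟨x⟩⟩ ⟨j, ⟨y⟩⟩ ⟨l, ⟨z⟩⟩
      exact mk_eq_mk F (add_assoc i j l) _ _ (mul_assoc (x : R) (y : R) (z : R)) }

/-- The graded ring structure on the pieces of a filtered ring. -/
instance pieceGRing (F : ℕ → Submodule k R) [IsRingFiltration F (prev F)] :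
    DirectSum.GRing (Piece F) :=
  { pieceGMonoid F with
    mul_zero := by
      rintro i j ⟨x⟩
      exact toPiece_eq F (x := ⟨_, _⟩) (y := 0) (by simp)
    zero_mul := by
      rintro i j ⟨y⟩
      exact toPiece_eq F (x := ⟨_, _⟩) (y := 0) (by simp)
    mul_add := by
      rintro i j ⟨x⟩ ⟨y⟩ ⟨z⟩
      exact congrArg (toPiece F (i + j)) (Subtype.ext (mul_add (x : R) (y : R) (z : R)))
    add_mul := by
      rintro i j ⟨x⟩ ⟨y⟩ ⟨z⟩
      exact congrArg (toPiece F (i + j)) (Subtype.ext (add_mul (x : R) (y : R) (z : R)))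
    natCast := fun n => n • toPiece F 0 ⟨1, SetLike.one_mem_graded F⟩
    natCast_zero := zero_smul _ _
    natCast_succ := fun n => succ_nsmul _ n
    intCast := fun n => n • toPiece F 0 ⟨1, SetLike.one_mem_graded F⟩
    intCast_ofNat := fun n => natCast_zsmul _ n
    intCast_negSucc_ofNat := fun n => negSucc_zsmul _ n }

/-- The graded module structure on the pieces of a filtered module: `x̄ ȳ = (x y)‾`. -/
instance pieceGmodule (F : ℕ → Submodule k R) [IsRingFiltration F (prev F)]
    (G : ℕ → Submodule k M) [IsModuleFiltration F (prev F) G (prev G)] :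
    DirectSum.Gmodule (Piece F) (Piece G) where
  smul {i j} := pieceSMul F G i j
  one_smul := by
    rintro ⟨i, ⟨x⟩⟩
    exact mk_eq_mk G (zero_add i) _ _ (one_smul R (x : M))
  mul_smul := by
    rintro ⟨i, ⟨x⟩⟩ ⟨j, ⟨y⟩⟩ ⟨l, ⟨z⟩⟩
    exact mk_eq_mk G (add_assoc i j l) _ _ (mul_smul (x : R) (y : R) (z : M))
  smul_add := by
    rintro i j ⟨x⟩ ⟨y⟩ ⟨z⟩
    exact congrArg (toPiece G (i + j)) (Subtype.ext (smul_add (x : R) (y : M) (z : M)))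
  smul_zero := by
    rintro i j ⟨x⟩
    exact toPiece_eq G (x := ⟨_, _⟩) (y := 0) (by simp)
  add_smul := by
    rintro i j ⟨x⟩ ⟨y⟩ ⟨z⟩
    exact congrArg (toPiece G (i + j)) (Subtype.ext (add_smul (x : R) (y : R) (z : M)))
  zero_smul := by
    rintro i j ⟨y⟩
    exact toPiece_eq G (x := ⟨_, _⟩) (y := 0) (by simp)

end Filt

/-! ### Vertex operator algebras and their admissible modules -/

/-- The Jacobi identity for `Y(·, z)` on `V` and `Y_M(·, z)` on `M`, written out in modes
(`Y(a, z) = ∑ aₙ z^(-n-1)`, where `VertexOperator.ncoeff` is the mode `aₙ`): for all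
`l, m, n ∈ ℤ`,
`∑ᵢ C(m,i) (a_{l+i} b)_{m+n-i} v
  = ∑ᵢ (-1)^i C(l,i) (a_{m+l-i} b_{n+i} v - (-1)^l b_{n+l-i} a_{m+i} v)`.
All sums are finite, because vertex operators take values in Laurent series. -/
def JacobiIdentity {V M : Type*} [AddCommGroup V] [Module ℂ V] [AddCommGroup M] [Module ℂ M]
    (Y : V →ₗ[ℂ] VertexOperator ℂ V) (YM : V →ₗ[ℂ] VertexOperator ℂ M) : Prop :=
  ∀ (a b : V) (v : M) (l m n : ℤ),
    ∑ᶠ i : ℕ, ((Ring.choose m i : ℤ) : ℂ) •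
        (YM ((Y a).ncoeff (l + i) b)).ncoeff (m + n - i) v
      = ∑ᶠ i : ℕ, ((-1 : ℂ) ^ i * ((Ring.choose l i : ℤ) : ℂ)) •
        ((YM a).ncoeff (m + l - i) ((YM b).ncoeff (n + i) v)
          - (-1 : ℂ) ^ l • (YM b).ncoeff (n + l - i) ((YM a).ncoeff (m + i) v))

/-- An `ℕ`-grading viewed as a `ℤ`-grading with zero components in negative degrees. -/
def intGrade {M : Type*} [AddCommGroup M] [Module ℂ M] (G : ℕ → Submodule ℂ M) :
    ℤ → Submodule ℂ M
  | Int.ofNat n => G n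
  | Int.negSucc _ => ⊥

/-- A vertex operator algebra `V = ⨁_{n ≥ 0} V_n` over `ℂ`, with `L(n) = ω_{n+1}`. -/
class VertexOperatorAlgebra (V : Type*) [AddCommGroup V] [Module ℂ V] where
  /-- the state-field correspondence `a ↦ Y(a, z)` -/
  Y : V →ₗ[ℂ] VertexOperator ℂ V
  /-- the vacuum vector `𝟏` -/
  vac : V
  /-- the conformal vector `ω` -/
  conf : V
  /-- the central charge -/
  centralCharge : ℂ
  /-- the homogeneous subspace `V_n` -/
  wt : ℕ → Submodule ℂ V
  isInternal : DirectSum.IsInternal wt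
  finiteDimensional : ∀ n, FiniteDimensional ℂ (wt n)
  vac_mem : vac ∈ wt 0
  conf_mem : conf ∈ wt 2
  vac_mode : ∀ (n : ℤ) (b : V), (Y vac).ncoeff n b = if n = -1 then b else 0
  mode_vac : ∀ (a : V) (n : ℤ), 0 ≤ n → (Y a).ncoeff n vac = 0
  mode_neg_one_vac : ∀ a : V, (Y a).ncoeff (-1) vac = a
  jacobi : JacobiIdentity Y Y
  virasoro : ∀ (m n : ℤ) (v : V),
    (Y conf).ncoeff (m + 1) ((Y conf).ncoeff (n + 1) v)
        - (Y conf).ncoeff (n + 1) ((Y conf).ncoeff (m + 1) v)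
      = ((m : ℂ) - n) • (Y conf).ncoeff (m + n + 1) v
        + if m + n = 0 then (((m : ℂ) ^ 3 - m) / 12 * centralCharge) • v else 0
  L_zero : ∀ (n : ℕ), ∀ a ∈ wt n, (Y conf).ncoeff 1 a = (n : ℂ) • a
  L_neg_one : ∀ (a b : V) (n : ℤ),
    (Y ((Y conf).ncoeff 0 a)).ncoeff n b = (-n : ℂ) • (Y a).ncoeff (n - 1) b

/-- `V` is of CFT type: `V_0 = ℂ 𝟏` (and `V_n = 0` for `n < 0`, which is built in above). -/
def VertexOperatorAlgebra.IsCFTType (V : Type*) [AddCommGroup V] [Module ℂ V]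
    [VertexOperatorAlgebra V] : Prop :=
  wt (V := V) 0 = Submodule.span ℂ {vac (V := V)}

/-- An admissible `V`-module `M = ⨁_{n ≥ 0} M(n)`. -/
class AdmissibleModule (V M : Type*) [AddCommGroup V] [Module ℂ V] [VertexOperatorAlgebra V]
    [AddCommGroup M] [Module ℂ M] where
  /-- the action `a ↦ Y_M(a, z)` -/
  Y : V →ₗ[ℂ] VertexOperator ℂ M
  /-- the homogeneous subspace `M(n)` -/
  deg : ℕ → Submodule ℂ M
  isInternal : DirectSum.IsInternal deg
  vac_mode : ∀ (n : ℤ) (v : M),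
    (Y (VertexOperatorAlgebra.vac (V := V))).ncoeff n v = if n = -1 then v else 0
  jacobi : JacobiIdentity (VertexOperatorAlgebra.Y (V := V)) Y
  /-- `a_n M(k) ⊆ M(wt a + k - n - 1)` -/
  mode_mem : ∀ (p : ℕ), ∀ a ∈ VertexOperatorAlgebra.wt (V := V) p, ∀ (n : ℤ) (k : ℕ),
    ∀ v ∈ deg k, (Y a).ncoeff n v ∈ intGrade deg (p + k - n - 1)

namespace VOA

open VertexOperatorAlgebra

variable (V M : Type*) [AddCommGroup V] [Module ℂ V] [VertexOperatorAlgebra V]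
  [AddCommGroup M] [Module ℂ M]

section Adjoint

variable {V M}

/-- `M = ⨁ G n` as an equivalence with the external direct sum. -/
def decomp {G : ℕ → Submodule ℂ M} (h : DirectSum.IsInternal G) : M ≃ₗ[ℂ] ⨁ n, G n :=
  (LinearEquiv.ofBijective (DirectSum.coeLinearMap G) h).symm

theorem decomp_symm_lof {G : ℕ → Submodule ℂ M} (h : DirectSum.IsInternal G) (n : ℕ) (x : G n) :
    (decomp h).symm (DirectSum.lof ℂ ℕ (fun n => G n) n x) = x :=
  DirectSum.coeLinearMap_lof G n x

theorem decomp_of_mem {G : ℕ → Submodule ℂ M} (h : DirectSum.IsInternal G) {n : ℕ} {x : M}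
    (hx : x ∈ G n) : decomp h x = DirectSum.lof ℂ ℕ (fun n => G n) n ⟨x, hx⟩ := by
  rw [← LinearEquiv.eq_symm_apply, decomp_symm_lof]

theorem grade_induction {G : ℕ → Submodule ℂ M} (h : DirectSum.IsInternal G) {p : M → Prop}
    (h0 : p 0) (hadd : ∀ x y, p x → p y → p (x + y)) (hG : ∀ n, ∀ x ∈ G n, p x) (x : M) : p x := by
  have hx : x ∈ ⨆ n, G n := by rw [h.submodule_iSup_eq_top]; trivial
  exact Submodule.iSup_induction G (motive := p) hx hG h0 hadd

/-- An eigenvector of `L(0)` with integral eigenvalue `c` is homogeneous of weight `c`. -/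
theorem mem_intGrade_of_L_zero {x : V} {c : ℤ} (hx : (Y (conf (V := V))).ncoeff 1 x = (c : ℂ) • x) :
    x ∈ intGrade (wt (V := V)) c := by
  set D := decomp (isInternal (V := V)) with hD
  have key : ∀ (y : V) (n : ℕ), ((D ((Y (conf (V := V))).ncoeff 1 y)) n : V)
      = (n : ℂ) • ((D y) n : V) := by
    intro y n
    refine grade_induction (isInternal (V := V))
      (p := fun y => ((D ((Y (conf (V := V))).ncoeff 1 y)) n : V) = (n : ℂ) • ((D y) n : V))
      (by simp) ?_ ?_ y
    · intro x y hx hy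
      simp only [map_add, DirectSum.add_apply, Submodule.coe_add, hx, hy, smul_add]
    · intro m x hx
      rw [L_zero m x hx, map_smul, hD, decomp_of_mem _ hx]
      simp only [DirectSum.smul_apply, Submodule.coe_smul]
      by_cases hmn : m = n
      · subst hmn; rfl
      · rw [DirectSum.lof_eq_of, DirectSum.of_eq_of_ne _ _ _ (Ne.symm hmn)]; simp
  have hz : ∀ n : ℕ, (n : ℤ) ≠ c → D x n = 0 := by
    intro n hn
    have h1 := key x n
    rw [hx, map_smul, DirectSum.smul_apply, Submodule.coe_smul, ← sub_eq_zero, ← sub_smul] at h1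
    rcases smul_eq_zero.1 h1 with h2 | h2
    · exact absurd (by exact_mod_cast (sub_eq_zero.1 h2).symm) hn
    · exact Subtype.ext h2
  have hxD : x = D.symm (D x) := (D.symm_apply_apply x).symm
  rcases c with c | c
  · have : D x = DirectSum.lof ℂ ℕ (fun n => wt (V := V) n) c (D x c) := by
      refine DFinsupp.ext fun n => ?_
      by_cases hn : n = c
      · subst hn
        exact (DirectSum.lof_apply (R := ℂ) (M := fun n => wt (V := V) n) n _).symm
      · rw [hz n (by simpa using hn), DirectSum.lof_eq_of, DirectSum.of_eq_of_ne _ _ _ hn]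
    rw [hxD, this]
    rw [hD, decomp_symm_lof]
    exact Subtype.property _
  · have : D x = 0 := DFinsupp.ext fun n => hz n (by simp)
    rw [hxD, this]
    simp

theorem mode_mem_intGrade (p : ℕ) (a : V) (ha : a ∈ wt p) (n : ℤ) (k : ℕ) (v : V)
    (hv : v ∈ wt k) : (Y a).ncoeff n v ∈ intGrade (wt (V := V)) (p + k - n - 1) := by
  apply mem_intGrade_of_L_zero
  have h := jacobi (V := V) conf a v 0 1 n
  rw [finsum_eq_sum_of_support_subset (s := Finset.range 2),
    finsum_eq_sum_of_support_subset (s := Finset.range 1)] at h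
  · simp only [Finset.sum_range_succ, Finset.sum_range_zero, Nat.cast_zero, Nat.cast_one,
      Ring.choose_zero_right, Ring.choose_one_right, zero_add, add_zero, sub_zero, pow_zero,
      zpow_zero, mul_one, one_smul, Int.cast_one, L_neg_one, L_zero p a ha,
      L_zero k v hv, map_smul, LinearMap.smul_apply, Pi.smul_apply] at h
    rw [eq_comm, sub_eq_iff_eq_add] at h
    rw [h, show (1 : ℤ) + n - 1 = n by ring, show (1 : ℤ) + n = n + 1 by ring]
    simp only [← add_smul]
    congr 1
    push_cast
    ring
  · intro i hi
    by_contra hi'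
    have : i ≠ 0 := by simpa using hi'
    exact hi (by simp [Ring.choose_zero_pos ℤ (Nat.pos_of_ne_zero this)])
  · intro i hi
    by_contra hi'
    have h2 : 1 < i := by simpa using hi'
    refine hi ?_
    have : Ring.choose (1 : ℤ) i = 0 := by
      have := Ring.choose_natCast (R := ℤ) 1 i
      rw [Nat.choose_eq_zero_of_lt h2] at this
      exact_mod_cast this
    simp [this]

/-- `V` as an admissible module over itself. -/
instance adjoint : AdmissibleModule V V where
  Y := Y
  deg := wt
  isInternal := isInternal
  vac_mode := vac_mode
  jacobi := jacobi
  mode_mem := mode_mem_intGrade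

end Adjoint

variable [AdmissibleModule V M]

/-- The mode `a_n v`, bilinear in `a ∈ V` and `v ∈ M`. -/
def mode (n : ℤ) : V →ₗ[ℂ] M →ₗ[ℂ] M :=
  (LinearMap.proj n).comp (VertexOperator.ncoeff.comp (AdmissibleModule.Y (V := V) (M := M)))

/-- The spanning elements `a¹_{-n₁} ⋯ aᵏ_{-n_k} w` with `k ≥ 0`, `aⁱ ∈ V_+` homogeneous,
`nᵢ ≥ 1` and `w ∈ W`. -/
inductive IsWord (W : Set M) : M → Prop
  | base (w : M) (hw : w ∈ W) : IsWord W w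
  | step (p : ℕ) (hp : 1 ≤ p) (a : V) (ha : a ∈ wt p) (n : ℕ) (hn : 1 ≤ n) (x : M)
      (hx : IsWord W x) : IsWord W (mode V M (-n) a x)

/-- `M` is strongly generated by the subset `W`. -/
def StronglyGeneratedBy (W : Set M) : Prop :=
  Submodule.span ℂ {x : M | IsWord V M W x} = ⊤

/-- `M` is strongly finitely generated. -/
def StronglyFinitelyGenerated : Prop :=
  ∃ W : Set M, W.Finite ∧ StronglyGeneratedBy V M W

/-- `C₂(M)`, spanned by all `a_{-2} v`. -/
def C2 : Submodule ℂ M :=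
  Submodule.span ℂ {x : M | ∃ (a : V) (v : M), x = mode V M (-2) a v}

/-- `Res_z (1+z)^p z^k Y_M(a, z) v = ∑_j C(p,j) a_{k+j} v`. -/
def res (p : ℕ) (k : ℤ) : V →ₗ[ℂ] M →ₗ[ℂ] M :=
  ∑ j ∈ Finset.range (p + 1), (p.choose j : ℂ) • mode V M (k + j)

/-- `O(M)`, spanned by `Res_z Y_M(a, z) v (1+z)^{wt a} / z²` for `a ∈ V` homogeneous, `v ∈ M`. -/
def O : Submodule ℂ M :=
  Submodule.span ℂ {x : M | ∃ (p : ℕ) (a : V) (v : M), a ∈ wt p ∧ x = res V M p (-2) a v}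

/-- The product `a ∗ v = Res_z Y_M(a, z) v (1+z)^{wt a} / z` for `a` homogeneous,
extended linearly to all `a ∈ V`. -/
def star : V →ₗ[ℂ] M →ₗ[ℂ] M :=
  (DirectSum.toModule ℂ ℕ (M →ₗ[ℂ] M)
    (fun p => (res V M p (-1)).comp (wt (V := V) p).subtype)).comp
    (decomp (isInternal (V := V))).toLinearMap

variable {V M}

theorem star_of_mem {p : ℕ} {a : V} (ha : a ∈ wt p) (v : M) :
    star V M a v = res V M p (-1) a v := by
  simp [star, decomp_of_mem _ ha]

/-! #### Zhu's algebra is associative and `A(M)` is a module over it -/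

theorem mem_intGrade_cast {G : ℕ → Submodule ℂ M} {x : M} {c : ℤ} {n : ℕ} (h : c = n)
    (hx : x ∈ intGrade G c) : x ∈ G n := by
  subst h
  exact hx

theorem mode_mem_deg {p k n : ℕ} {c : ℤ} {a : V} {v : M} (ha : a ∈ wt p)
    (hv : v ∈ AdmissibleModule.deg V k) (h : (p : ℤ) + k - c - 1 = n) :
    mode V M c a v ∈ AdmissibleModule.deg V n :=
  mem_intGrade_cast h (AdmissibleModule.mode_mem p a ha c k v hv)

theorem mode_mem_wt {p k n : ℕ} {c : ℤ} {a b : V} (ha : a ∈ wt p)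
    (hb : b ∈ wt k) (h : (p : ℤ) + k - c - 1 = n) : mode V V c a b ∈ wt n :=
  mode_mem_deg (M := V) ha hb h

theorem mode_truncation (a : V) (v : M) : ∃ N : ℤ, ∀ n : ℤ, N ≤ n → mode V M n a v = 0 := by
  set A := AdmissibleModule.Y (M := M) a
  refine ⟨-HahnSeries.order ((HahnModule.of ℂ).symm (A v)), fun n hn => ?_⟩
  exact VertexOperator.ncoeff_eq_zero_of_lt_order A n v (by omega)

theorem vac_mode_eq (n : ℤ) (v : M) :
    mode V M n (vac (V := V)) v = if n = -1 then v else 0 :=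
  AdmissibleModule.vac_mode n v

/-- The Jacobi identity with explicit finite ranges of summation. -/
theorem jacobi_finite (a b : V) (v : M) (l k : ℤ) : ∃ N : ℕ, ∀ p m t : ℕ, m ≤ p →
    ∑ i ∈ Finset.range (p + 1), (m.choose i : ℂ) •
        mode V M (m + (k + t) - i) (mode V V (l + i) a b) v
      = ∑ i ∈ Finset.range (N + 1), ((-1 : ℂ) ^ i * ((Ring.choose l i : ℤ) : ℂ)) •
        (mode V M (m + l - i) a (mode V M (k + t + i) b v)
          - (-1 : ℂ) ^ l • mode V M (k + t + l - i) b (mode V M (m + i) a v)) := by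
  obtain ⟨N1, h1⟩ := mode_truncation a v
  obtain ⟨N2, h2⟩ := mode_truncation b v
  refine ⟨max N1.toNat (N2 - k).toNat, fun p m t hm => ?_⟩
  have h := AdmissibleModule.jacobi (V := V) (M := M) a b v l m (k + t)
  rw [finsum_eq_sum_of_support_subset (s := Finset.range (p + 1)),
    finsum_eq_sum_of_support_subset (s := Finset.range (max N1.toNat (N2 - k).toNat + 1))] at h
  · simp only [Ring.choose_natCast] at h
    exact_mod_cast h
  · intro i hi
    by_contra hi'
    have h3 : max N1.toNat (N2 - k).toNat + 1 ≤ i := by simpa using hi'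
    refine hi ?_
    have e1 : mode V M (m + i) a v = 0 := h1 _ (by omega)
    have e2 : mode V M (k + t + i) b v = 0 := h2 _ (by omega)
    change _ • (mode V M _ a (mode V M (k + t + i) b v)
      - _ • mode V M _ b (mode V M (m + i) a v)) = 0
    rw [e1, e2]
    simp
  · intro i hi
    by_contra hi'
    have h3 : p + 1 ≤ i := by simpa using hi'
    refine hi ?_
    simp [Ring.choose_natCast, Nat.choose_eq_zero_of_lt (show m < i by omega)]

/-- Binomial sums `∑_s C(n,s) X_s`. -/
def bsum (n : ℕ) (X : ℕ → M) : M := ∑ s ∈ Finset.range (n + 1), (n.choose s : ℂ) • X s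

theorem bsum_succ (n : ℕ) (X : ℕ → M) :
    bsum (n + 1) X = bsum n X + bsum n (fun s => X (s + 1)) := by
  have h : bsum n X = ∑ s ∈ Finset.range (n + 2), (n.choose s : ℂ) • X s := by
    rw [Finset.sum_range_succ]; simp [bsum]
  rw [h, bsum, bsum, Finset.sum_range_succ', Finset.sum_range_succ' (n := n + 1)]
  simp only [Nat.choose_succ_succ, Nat.cast_add, add_smul, Finset.sum_add_distrib,
    Nat.choose_zero_right]
  abel

theorem bsum_add_apply (n : ℕ) (X Z : ℕ → M) :
    bsum n (fun s => X s + Z s) = bsum n X + bsum n Z := by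
  simp [bsum, Finset.sum_add_distrib]

theorem bsum_smul (n : ℕ) (c : ℂ) (X : ℕ → M) :
    bsum n (fun s => c • X s) = c • bsum n X := by
  simp [bsum, Finset.smul_sum, smul_comm c]

theorem bsum_bsum (n m : ℕ) (X : ℕ → M) :
    bsum n (fun u => bsum m (fun t => X (u + t))) = bsum (n + m) X := by
  induction n generalizing X with
  | zero => simp [bsum]
  | succ n ih =>
    rw [bsum_succ, ih, show n + 1 + m = n + m + 1 by omega, bsum_succ, ← ih (fun s => X (s + 1))]
    congr 2
    funext u
    congr 1
    funext t
    congr 1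
    omega

theorem bsum_mul_index (n : ℕ) (X : ℕ → M) :
    bsum (n + 1) (fun s => (s : ℂ) • X s) = ((n : ℂ) + 1) • bsum n (fun s => X (s + 1)) := by
  rw [bsum, Finset.sum_range_succ', bsum, Finset.smul_sum]
  simp only [Nat.cast_zero, zero_smul, smul_zero, add_zero, smul_smul]
  refine Finset.sum_congr rfl fun s _ => ?_
  congr 1
  exact_mod_cast (Nat.add_one_mul_choose_eq n s).symm

theorem bsum_choose (p i : ℕ) (hi : i ≤ p) (X : ℕ → M) :
    ∑ m ∈ Finset.range (p + 1), (p.choose m : ℂ) • (m.choose i : ℂ) • X m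
      = (p.choose i : ℂ) • bsum (p - i) (fun u => X (i + u)) := by
  rw [show p + 1 = i + (p - i + 1) by omega, Finset.sum_range_add, bsum, Finset.smul_sum]
  rw [Finset.sum_eq_zero (s := Finset.range i), zero_add]
  · refine Finset.sum_congr rfl fun u hu => ?_
    have hu' : u ≤ p - i := by simpa [Nat.lt_succ_iff] using hu
    rw [smul_smul, smul_smul]
    congr 1
    have := Nat.choose_mul (n := p) (k := i + u) (s := i) (by omega)
    rw [show i + u - i = u by omega] at this
    exact_mod_cast this
  · intro m hm
    simp [Nat.choose_eq_zero_of_lt (Finset.mem_range.1 hm)]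

theorem res_apply (p : ℕ) (k : ℤ) (a : V) (v : M) :
    res V M p k a v = bsum p (fun s => mode V M (k + s) a v) := by
  simp [res, bsum]

theorem res_succ (p : ℕ) (k : ℤ) (a : V) (v : M) :
    res V M (p + 1) k a v = res V M p k a v + res V M p (k + 1) a v := by
  simp only [res_apply, bsum_succ]
  congr 2
  funext s
  push_cast
  congr 3
  ring

/-- The residue form of the Jacobi identity against `(1+z₁)^p (1+z₂)^e z₂^k (z₁-z₂)^l`. -/
theorem res_jacobi (a b : V) (v : M) (l k : ℤ) (p e : ℕ) : ∃ N : ℕ,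
    ∑ j ∈ Finset.range (p + 1), (p.choose j : ℂ) •
        res V M (p + e - j) k (mode V V (l + j) a b) v
      = ∑ i ∈ Finset.range (N + 1), ((-1 : ℂ) ^ i * ((Ring.choose l i : ℤ) : ℂ)) •
        (res V M p (l - i) a (res V M e (k + i) b v)
          - (-1 : ℂ) ^ l • res V M e (k + l - i) b (res V M p i a v)) := by
  obtain ⟨N, hN⟩ := jacobi_finite a b v l k
  refine ⟨N, ?_⟩
  have h : bsum p (fun m => bsum e (fun t => ∑ i ∈ Finset.range (p + 1), (m.choose i : ℂ) •
        mode V M (m + (k + t) - i) (mode V V (l + i) a b) v))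
      = bsum p (fun m => bsum e (fun t => ∑ i ∈ Finset.range (N + 1),
        ((-1 : ℂ) ^ i * ((Ring.choose l i : ℤ) : ℂ)) •
        (mode V M (m + l - i) a (mode V M (k + t + i) b v)
          - (-1 : ℂ) ^ l • mode V M (k + t + l - i) b (mode V M (m + i) a v)))) := by
    refine Finset.sum_congr rfl fun m hm => ?_
    congr 1
    refine Finset.sum_congr rfl fun t _ => ?_
    exact congrArg _ (hN p m t (by simpa [Nat.lt_succ_iff] using hm))
  have sum_out : ∀ (s : Finset ℕ) (n : ℕ) (X : ℕ → ℕ → M),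
      bsum n (fun u => ∑ i ∈ s, X i u) = ∑ i ∈ s, bsum n (X i) := by
    intro s n X
    simp only [bsum, Finset.smul_sum]
    exact Finset.sum_comm
  have bsub : ∀ (n : ℕ) (X Z : ℕ → M),
      bsum n (fun s => X s - Z s) = bsum n X - bsum n Z := by
    intro n X Z
    simp [bsum, smul_sub, Finset.sum_sub_distrib]
  have bmap : ∀ (n : ℕ) (f : M →ₗ[ℂ] M) (X : ℕ → M),
      bsum n (fun s => f (X s)) = f (bsum n X) := by
    intro n f X
    simp [bsum]
  have bcomm : ∀ (n m : ℕ) (X : ℕ → ℕ → M),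
      bsum n (fun u => bsum m (fun t => X u t)) = bsum m (fun t => bsum n (fun u => X u t)) := by
    intro n m X
    simp only [bsum, Finset.smul_sum]
    rw [Finset.sum_comm]
    exact Finset.sum_congr rfl fun _ _ => Finset.sum_congr rfl fun _ _ => smul_comm _ _ _
  simp only [sum_out, bsum_smul, bsub] at h
  refine Eq.trans ?_ (h.trans ?_)
  · refine Finset.sum_congr rfl fun i hi => ?_
    have hi' : i ≤ p := by simpa [Nat.lt_succ_iff] using hi
    rw [bsum, bsum_choose p i hi', res_apply, show p + e - i = (p - i) + e by omega, ← bsum_bsum]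
    congr 2
    funext u
    congr 1
    funext t
    congr 3
    push_cast
    ring
  · refine Finset.sum_congr rfl fun i _ => ?_
    congr 2
    · rw [res_apply]
      congr 1
      funext m
      rw [res_apply, ← bmap, show (l - i + m : ℤ) = m + l - i by ring]
      congr 1
      funext t
      rw [show (k + i + t : ℤ) = k + t + i by ring]
    · rw [bcomm, res_apply]
      congr 2
      funext t
      rw [res_apply, ← bmap, show (k + l - i + t : ℤ) = k + t + l - i by ring]
      congr 1
      funext m
      rw [show (i + m : ℤ) = m + i by ring]

/-- `(a_{-2} 𝟏)_n = -n a_{n-1}`. -/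
theorem mode_derivative (a : V) (n : ℤ) (v : M) :
    mode V M n (mode V V (-2) a vac) v = (-n : ℂ) • mode V M (n - 1) a v := by
  have hc : ∀ i : ℕ, (-1 : ℂ) ^ i * ((Ring.choose (-2 : ℤ) i : ℤ) : ℂ) = i + 1 := by
    intro i
    rw [Ring.choose_neg, ← Ring.multichoose_eq, Ring.multichoose_two]
    rcases Nat.even_or_odd i with h | h
    · simp [h, Int.negOnePow_even]
    · simp [h, Int.negOnePow_odd, add_comm]
  have h := AdmissibleModule.jacobi (V := V) (M := M) a vac v (-2) 0 n
  have hl : ∑ᶠ i : ℕ, ((Ring.choose (0 : ℤ) i : ℤ) : ℂ) •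
      mode V M (0 + n - i) (mode V V (-2 + i) a vac) v
      = mode V M n (mode V V (-2) a vac) v := by
    rw [finsum_eq_single _ 0]
    · simp
    · intro i hi
      simp [Ring.choose_zero_pos ℤ (Nat.pos_of_ne_zero hi)]
  rw [← hl]
  refine h.trans ?_
  change ∑ᶠ i : ℕ, ((-1 : ℂ) ^ i * ((Ring.choose (-2 : ℤ) i : ℤ) : ℂ)) •
      (mode V M (0 + -2 - i) a (mode V M (n + i) vac v)
        - (-1 : ℂ) ^ (-2 : ℤ) • mode V M (n + -2 - i) vac (mode V M (0 + i) a v)) = _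
  simp only [hc, vac_mode_eq]
  rcases lt_trichotomy n 0 with hn | hn | hn
  · obtain ⟨j, hj⟩ := Int.eq_ofNat_of_zero_le (show 0 ≤ -1 - n by omega)
    obtain rfl : n = -1 - j := by omega
    rw [finsum_eq_single _ j]
    · rw [if_pos (by ring), if_neg (by omega), smul_zero, sub_zero,
        show (0 + -2 - j : ℤ) = -1 - j - 1 by ring]
      congr 1
      push_cast
      ring
    · intro i hi
      rw [if_neg (by omega), if_neg (by omega)]
      simp
  · subst hn
    rw [finsum_eq_zero_of_forall_eq_zero]
    · simp
    · intro i
      rw [if_neg (by omega), if_neg (by omega)]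
      simp
  · obtain ⟨j, hj⟩ := Int.eq_ofNat_of_zero_le (show 0 ≤ n - 1 by omega)
    obtain rfl : n = j + 1 := by omega
    rw [finsum_eq_single _ j]
    · rw [if_neg (by omega), if_pos (by ring), map_zero, zero_sub,
        show (0 + j : ℤ) = j + 1 - 1 by ring, smul_neg, ← neg_smul, smul_smul]
      congr 1
      push_cast
      norm_num
    · intro i hi
      rw [if_neg (by omega), if_neg (by omega)]
      simp

theorem res_mem_O {p : ℕ} {a : V} (ha : a ∈ wt p) (m : ℕ) (v : M) :
    res V M p (-2 - m) a v ∈ O V M := by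
  induction m generalizing p a with
  | zero => exact Submodule.subset_span ⟨p, a, v, ha, by simp⟩
  | succ m ih =>
    have ha' : mode V V (-2) a vac ∈ wt (p + 1) :=
      mode_mem_wt ha vac_mem (by push_cast; ring)
    set X : ℕ → M := fun s => mode V M (-2 - (m + 1 : ℕ) + s) a v with hX
    have e1 : res V M (p + 1) (-2 - m) (mode V V (-2) a vac) v
        = ((m : ℂ) + 2) • bsum (p + 1) X
          - bsum (p + 1) (fun s => (s : ℂ) • X s) := by
      rw [res_apply, bsum, bsum, bsum, Finset.smul_sum, ← Finset.sum_sub_distrib]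
      refine Finset.sum_congr rfl fun s _ => ?_
      rw [mode_derivative, hX,
        show (-2 - (m : ℤ) + s - 1) = -2 - ((m + 1 : ℕ) : ℤ) + s by push_cast; ring]
      simp only [smul_smul, ← sub_smul]
      congr 1
      push_cast
      ring
    have e2 : res V M p (-2 - m) a v = bsum p (fun s => X (s + 1)) := by
      rw [res_apply]
      congr 1
      funext s
      rw [hX]
      congr 3
      push_cast
      ring
    have e3 : res V M p (-2 - (m + 1 : ℕ)) a v = bsum p X := res_apply _ _ _ _
    rw [bsum_mul_index, bsum_succ, ← e2, ← e3] at e1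
    have h1 := ih ha'
    have h2 := ih ha
    have e4 : ((m : ℂ) + 2) • res V M p (-2 - (m + 1 : ℕ)) a v
        = res V M (p + 1) (-2 - m) (mode V V (-2) a vac) v
          - ((m : ℂ) + 2 - (p + 1)) • res V M p (-2 - m) a v := by
      rw [e1]
      module
    have h3 : ((m : ℂ) + 2) • res V M p (-2 - (m + 1 : ℕ)) a v ∈ O V M := by
      rw [e4]
      exact sub_mem h1 (Submodule.smul_mem _ _ h2)
    exact (Submodule.smul_mem_iff _ (by exact_mod_cast (show m + 2 ≠ 0 by omega))).1 h3

theorem res_mem_O_of_le {p : ℕ} {a : V} (ha : a ∈ wt p) {c : ℤ} (hc : c ≤ -2) (v : M) :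
    res V M p c a v ∈ O V M := by
  obtain ⟨m, hm⟩ := Int.eq_ofNat_of_zero_le (show 0 ≤ -2 - c by omega)
  obtain rfl : c = -2 - m := by omega
  exact res_mem_O ha m v

theorem star_res_sub_mem {p q : ℕ} {a b : V} (ha : a ∈ wt p) (hb : b ∈ wt q) {k : ℤ}
    (hk : k ≤ -1) (v : M) :
    ∑ j ∈ Finset.range (p + 1), (p.choose j : ℂ) •
        res V M (p + q - j) k (mode V V (-1 + j) a b) v
      - star V M a (res V M q k b v) ∈ O V M := by
  obtain ⟨N, hN⟩ := res_jacobi a b v (-1) k p q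
  rw [hN, star_of_mem ha, Finset.sum_range_succ', add_sub_assoc]
  refine add_mem (Submodule.sum_mem _ fun i _ => Submodule.smul_mem _ _
    (sub_mem (res_mem_O_of_le ha (by push_cast; omega) _)
      (Submodule.smul_mem _ _ (res_mem_O_of_le hb (by push_cast; omega) _)))) ?_
  simp only [Nat.cast_zero, pow_zero, Ring.choose_zero_right, Int.cast_one, mul_one, one_smul,
    sub_zero, add_zero]
  rw [sub_right_comm, sub_self, zero_sub]
  exact neg_mem (Submodule.smul_mem _ _ (res_mem_O_of_le hb (by omega) _))

theorem star_assoc (a b : V) (v : M) :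
    star V M (star V V a b) v - star V M a (star V M b v) ∈ O V M := by
  refine grade_induction (isInternal (V := V))
    (p := fun a => star V M (star V V a b) v - star V M a (star V M b v) ∈ O V M)
    (by simp) ?_ ?_ a
  · intro x y hx hy
    simp only [map_add, LinearMap.add_apply, add_sub_add_comm]
    exact add_mem hx hy
  intro p a ha
  refine grade_induction (isInternal (V := V))
    (p := fun b => star V M (star V V a b) v - star V M a (star V M b v) ∈ O V M)
    (by simp) ?_ ?_ b
  · intro x y hx hy
    simp only [map_add, LinearMap.add_apply, add_sub_add_comm]
    exact add_mem hx hy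
  intro q b hb
  have h := star_res_sub_mem ha hb (k := -1) le_rfl v
  rw [star_of_mem hb]
  convert h using 2
  rw [star_of_mem ha, res, LinearMap.sum_apply, LinearMap.sum_apply, map_sum, LinearMap.sum_apply]
  refine Finset.sum_congr rfl fun j hj => ?_
  have hj' : j ≤ p := by simpa [Nat.lt_succ_iff] using hj
  simp only [LinearMap.smul_apply, map_smul]
  rw [star_of_mem (mode_mem_wt ha hb (n := p + q - j) (by omega))]

theorem star_mem_O (a : V) {x : M} (hx : x ∈ O V M) : star V M a x ∈ O V M := by
  refine grade_induction (isInternal (V := V)) (p := fun a => star V M a x ∈ O V M)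
    (by simp) (fun x y hx hy => by simpa using add_mem hx hy) ?_ a
  intro p a ha
  suffices h : O V M ≤ (O V M).comap (star V M a) from h hx
  refine Submodule.span_le.2 ?_
  rintro _ ⟨q, b, v, hb, rfl⟩
  have h := star_res_sub_mem ha hb (k := -2) (by omega) v
  refine (Submodule.sub_mem_iff_right (O V M) (Submodule.sum_mem _ fun j hj => ?_)).1 h
  have hj' : j ≤ p := by simpa [Nat.lt_succ_iff] using hj
  exact Submodule.smul_mem _ _
    (res_mem_O_of_le (mode_mem_wt ha hb (n := p + q - j) (by omega)) le_rfl v)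

theorem O_star_mem {x : V} (hx : x ∈ O V V) (v : M) : star V M x v ∈ O V M := by
  suffices h : O V V ≤ (O V M).comap ((star V M).flip v) from h hx
  refine Submodule.span_le.2 ?_
  rintro _ ⟨p, a, b, ha, rfl⟩
  change star V M (res V V p (-2) a b) v ∈ O V M
  refine grade_induction (isInternal (V := V))
    (p := fun b => star V M (res V V p (-2) a b) v ∈ O V M)
    (by simp) (fun x y hx hy => by simpa using add_mem hx hy) ?_ b
  intro q b hb
  obtain ⟨N, hN⟩ := res_jacobi a b v (-2) (-1) p (q + 1)
  have e : star V M (res V V p (-2) a b) v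
      = ∑ j ∈ Finset.range (p + 1), (p.choose j : ℂ) •
        res V M (p + (q + 1) - j) (-1) (mode V V (-2 + j) a b) v := by
    rw [res, LinearMap.sum_apply, LinearMap.sum_apply, map_sum, LinearMap.sum_apply]
    refine Finset.sum_congr rfl fun j hj => ?_
    have hj' : j ≤ p := by simpa [Nat.lt_succ_iff] using hj
    simp only [LinearMap.smul_apply, map_smul]
    rw [star_of_mem (mode_mem_wt ha hb (n := p + (q + 1) - j) (by omega))]
  rw [e, hN]
  refine Submodule.sum_mem _ fun i _ => Submodule.smul_mem _ _
    (sub_mem (res_mem_O_of_le ha (by omega) _) (Submodule.smul_mem _ _ ?_))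
  rw [res_succ]
  exact add_mem (res_mem_O_of_le hb (by omega) _) (res_mem_O_of_le hb (by omega) _)

theorem vac_star (v : M) : star V M vac v = v := by
  rw [star_of_mem vac_mem]
  simp [res, vac_mode_eq]

theorem star_vac (a : V) : star V V a vac = a := by
  refine grade_induction (isInternal (V := V)) (p := fun a => star V V a vac = a)
    (by simp) (fun x y hx hy => by simp [hx, hy]) ?_ a
  intro p a ha
  rw [star_of_mem ha, res, LinearMap.sum_apply, LinearMap.sum_apply, Finset.sum_eq_single 0]
  · have : mode V V (-1) a vac = a := mode_neg_one_vac a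
    simp [this]
  · intro j _ hj
    have : mode V V (-1 + j) a vac = 0 := mode_vac a _ (by omega)
    simp [this]
  · simp

variable (V M)

/-- Zhu's algebra `A(V) = V / O(V)`. -/
def ZhuAlgebra : Type _ := V ⧸ O V V

/-- The left `A(V)`-module `A(M) = M / O(M)`. -/
def ZhuModule : Type _ := M ⧸ O V M

instance : AddCommGroup (ZhuAlgebra V) := inferInstanceAs (AddCommGroup (V ⧸ O V V))

instance : Module ℂ (ZhuAlgebra V) := inferInstanceAs (Module ℂ (V ⧸ O V V))

instance : AddCommGroup (ZhuModule V M) := inferInstanceAs (AddCommGroup (M ⧸ O V M))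

instance : Module ℂ (ZhuModule V M) := inferInstanceAs (Module ℂ (M ⧸ O V M))

/-- The projection `V → A(V)`. -/
def toZhuAlgebra : V →ₗ[ℂ] ZhuAlgebra V := (O V V).mkQ

/-- The projection `M → A(M)`. -/
def toZhuModule : M →ₗ[ℂ] ZhuModule V M := (O V M).mkQ

/-- The map `A(V) × A(M) → A(M)` induced by `a ∗ v`. -/
def act : (V ⧸ O V V) →ₗ[ℂ] (M ⧸ O V M) →ₗ[ℂ] (M ⧸ O V M) :=
  (O V V).liftQ
    { toFun := fun a => (O V M).mapQ (O V M) (star V M a) (fun _ hx => star_mem_O a hx)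
      map_add' := fun a b => by ext v; simp
      map_smul' := fun c a => by ext v; simp }
    (fun x hx => by
      ext v
      simpa using O_star_mem hx v)

/-- `A(V)` with the product `∗` is an associative ring with unit `𝟏 + O(V)`. -/
instance : Ring (ZhuAlgebra V) :=
  { (inferInstance : AddCommGroup (ZhuAlgebra V)) with
    mul := fun x y => act V V x y
    one := toZhuAlgebra V vac
    left_distrib := fun x y z => map_add (act V V x) y z
    right_distrib := fun x y z => LinearMap.map_add₂ (act V V) x y z
    zero_mul := fun x => LinearMap.map_zero₂ (act V V) x
    mul_zero := fun x => map_zero (act V V x)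
    one_mul := by
      rintro ⟨x⟩
      exact congrArg (toZhuAlgebra V) (vac_star x)
    mul_one := by
      rintro ⟨x⟩
      exact congrArg (toZhuAlgebra V) (star_vac x)
    mul_assoc := by
      rintro ⟨x⟩ ⟨y⟩ ⟨z⟩
      exact (Submodule.Quotient.eq _).2 (star_assoc x y z) }

/-- `A(M)` is a left `A(V)`-module under `a ∗ v`. -/
instance : Module (ZhuAlgebra V) (ZhuModule V M) where
  smul x y := act V M x y
  one_smul := by
    rintro ⟨x⟩
    exact congrArg (toZhuModule V M) (vac_star x)
  mul_smul := by
    rintro ⟨x⟩ ⟨y⟩ ⟨z⟩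
    exact (Submodule.Quotient.eq _).2 (star_assoc x y z)
  smul_zero x := map_zero (act V M x)
  smul_add x y z := map_add (act V M x) y z
  add_smul x y z := LinearMap.map_add₂ (act V M) x y z
  zero_smul x := LinearMap.map_zero₂ (act V M) x

/-! #### The filtrations and the associated graded objects -/

/-- `⨁_{i ≤ n} G i`. -/
def upTo {M : Type*} [AddCommGroup M] [Module ℂ M] (G : ℕ → Submodule ℂ M) (n : ℕ) :
    Submodule ℂ M :=
  ⨆ i ∈ Finset.range (n + 1), G i

/-- `A(V)_n`, the image of `⨁_{i ≤ n} V_i` in `A(V)`. -/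
def algFil (n : ℕ) : Submodule ℂ (ZhuAlgebra V) := (upTo (wt (V := V)) n).map (toZhuAlgebra V)

/-- `A(M)_n`, the image of `⨁_{i ≤ n} M(i)` in `A(M)`. -/
def modFil (n : ℕ) : Submodule ℂ (ZhuModule V M) :=
  (upTo (AdmissibleModule.deg (M := M) V) n).map (toZhuModule V M)

theorem le_upTo {G : ℕ → Submodule ℂ M} {i n : ℕ} (h : i ≤ n) : G i ≤ upTo G n :=
  le_iSup₂_of_le (f := fun i (_ : i ∈ Finset.range (n + 1)) => G i) i
    (Finset.mem_range.2 (by omega)) le_rfl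

theorem upTo_mono (G : ℕ → Submodule ℂ M) : Monotone (upTo G) := fun _ _ h =>
  iSup₂_le fun _ hi => le_upTo M (by have := Finset.mem_range.1 hi; omega)

theorem intGrade_le_upTo {G : ℕ → Submodule ℂ M} {c : ℤ} {n : ℕ} (h : c ≤ n) :
    intGrade G c ≤ upTo G n := by
  rcases c with c | c
  · exact le_upTo M (by simpa using h)
  · exact bot_le

theorem star_mem_upTo {m n : ℕ} {a : V} {v : M} (ha : a ∈ upTo (wt (V := V)) m)
    (hv : v ∈ upTo (AdmissibleModule.deg (M := M) V) n) :
    star V M a v ∈ upTo (AdmissibleModule.deg (M := M) V) (m + n) := by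
  set D := upTo (AdmissibleModule.deg (M := M) V) (m + n)
  suffices h : upTo (wt (V := V)) m ≤ D.comap ((star V M).flip v) from h ha
  refine iSup₂_le fun p hp a ha => ?_
  suffices h : upTo (AdmissibleModule.deg (M := M) V) n ≤ D.comap (star V M a) from h hv
  refine iSup₂_le fun k hk v hv => ?_
  have hp' := Finset.mem_range.1 hp
  have hk' := Finset.mem_range.1 hk
  change star V M a v ∈ D
  rw [star_of_mem ha, res, LinearMap.sum_apply, LinearMap.sum_apply]
  refine Submodule.sum_mem _ fun j _ => Submodule.smul_mem _ _ ?_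
  exact intGrade_le_upTo M (by omega) (AdmissibleModule.mode_mem p a ha (-1 + j) k v hv)

instance : IsRingFiltration (algFil V) (Filt.prev (algFil V)) where
  toIsFiltration := Filt.isFiltration fun _ _ h => Submodule.map_mono (upTo_mono V _ h)
  one_mem := ⟨vac, le_upTo V le_rfl vac_mem, rfl⟩
  mul_mem := by
    rintro i j _ _ ⟨x, hx, rfl⟩ ⟨y, hy, rfl⟩
    exact ⟨star V V x y, star_mem_upTo V V hx hy, rfl⟩

instance : IsModuleFiltration (algFil V) (Filt.prev (algFil V))
    (modFil V M) (Filt.prev (modFil V M)) where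
  toIsFiltration := Filt.isFiltration fun _ _ h => Submodule.map_mono (upTo_mono M _ h)
  smul_mem := by
    rintro i j _ _ ⟨x, hx, rfl⟩ ⟨y, hy, rfl⟩
    exact ⟨star V M x y, star_mem_upTo V M hx hy, rfl⟩

/-- The graded ring `gr A(V) = ⨁ A(V)_n / A(V)_{n-1}`. -/
abbrev GrZhuAlgebra : Type _ := Filt.Gr (algFil V)

/-- The graded `gr A(V)`-module `gr A(M) = ⨁ A(M)_n / A(M)_{n-1}`. -/
abbrev GrZhuModule : Type _ := Filt.Gr (modFil V M)

/-- `M(n) → A(M)_n / A(M)_{n-1}`, `v ↦ v̄`. -/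
def symbol (n : ℕ) : AdmissibleModule.deg (M := M) V n →ₗ[ℂ] Filt.Piece (modFil V M) n :=
  (Filt.toPiece (modFil V M) n).comp
    ((toZhuModule V M).restrict fun _ hv => ⟨_, le_upTo M le_rfl hv, rfl⟩)

/-- The linear map `M → gr A(M)` with `v ↦ v̄ ∈ A(M)_n / A(M)_{n-1}` for `v ∈ M(n)`. -/
def symbolMap : M →ₗ[ℂ] GrZhuModule V M :=
  (DirectSum.toModule ℂ ℕ (GrZhuModule V M) fun n =>
    (DirectSum.lof ℂ ℕ (Filt.Piece (modFil V M)) n).comp (symbol V M n)).comp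
    (decomp (AdmissibleModule.isInternal (V := V) (M := M))).toLinearMap

theorem symbolMap_of_mem {n : ℕ} {v : M} (hv : v ∈ AdmissibleModule.deg V n) :
    symbolMap V M v = DirectSum.lof ℂ ℕ (Filt.Piece (modFil V M)) n (symbol V M n ⟨v, hv⟩) := by
  simp [symbolMap, decomp_of_mem _ hv]

theorem C2_le_ker : C2 V M ≤ LinearMap.ker (symbolMap V M) := by
  refine Submodule.span_le.2 ?_
  rintro _ ⟨a, v, rfl⟩
  change symbolMap V M (mode V M (-2) a v) = 0
  refine grade_induction (isInternal (V := V))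
    (p := fun a => symbolMap V M (mode V M (-2) a v) = 0)
    (by simp) (fun x y hx hy => by simp [hx, hy]) ?_ a
  intro p a ha
  refine grade_induction (AdmissibleModule.isInternal (V := V) (M := M))
    (p := fun v => symbolMap V M (mode V M (-2) a v) = 0)
    (by simp) (fun x y hx hy => by simp [hx, hy]) ?_ v
  intro k v hv
  have hm : mode V M (-2) a v ∈ AdmissibleModule.deg V (p + k + 1) :=
    mode_mem_deg ha hv (by push_cast; ring)
  rw [symbolMap_of_mem V M hm]
  have hz : symbol V M (p + k + 1) ⟨_, hm⟩ = 0 := by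
    refine (Submodule.Quotient.mk_eq_zero _).2 ?_
    change toZhuModule V M (mode V M (-2) a v) ∈ modFil V M (p + k)
    have h1 : res V M p (-2) a v ∈ O V M := res_mem_O_of_le ha le_rfl v
    have h2 : res V M p (-2) a v = ∑ j ∈ Finset.range p,
        (p.choose (j + 1) : ℂ) • mode V M (-2 + (j + 1 : ℕ)) a v + mode V M (-2) a v := by
      rw [res, LinearMap.sum_apply, LinearMap.sum_apply, Finset.sum_range_succ']
      simp
    have h3 : toZhuModule V M (res V M p (-2) a v) = 0 :=
      (Submodule.Quotient.mk_eq_zero _).2 h1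
    rw [h2, map_add] at h3
    rw [eq_neg_of_add_eq_zero_right h3]
    refine neg_mem ⟨_, Submodule.sum_mem _ fun j _ => Submodule.smul_mem _ _ ?_, rfl⟩
    exact intGrade_le_upTo M (by push_cast; omega) (AdmissibleModule.mode_mem p a ha _ k v hv)
  rw [hz, map_zero]

/-- The map `ψ : M / C₂(M) → gr A(M)`, `v + C₂(M) ↦ v̄ ∈ A(M)_n / A(M)_{n-1}` for `v ∈ M(n)`. -/
def psi : (M ⧸ C2 V M) →ₗ[ℂ] GrZhuModule V M :=
  (C2 V M).liftQ (symbolMap V M) (C2_le_ker V M)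

end VOA

end

/-! The argument compares a mode `a_c v` with the residue `Res_z (1+z)^p z^c Y_M(a, z) v`, where `a`
has weight `p`. The residue is `∑_j C(p,j) a_{c+j} v`, and for homogeneous `v` each increase of `j`
by one lowers the degree by one. So `a_c v` and the residue agree in `A(M)` up to the next lower
filtration step (`toZhuModule_mode_sub_res_mem_prev`).

Two cases matter. If `c ≤ -2`, the residue lies in `O(M)`, so the symbol of `a_c v` vanishes
(`symbolMap_mode_of_le`). If `c = -1`, the residue is `a ∗ v`, so the symbol of `a_{-1} v` is `ā`
acting on the symbol of `v` (`symbolMap_mode_neg_one`). Hence the symbol of a word `a¹_{-n₁} ⋯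
aᵏ_{-n_k} w` is `ā¹ ⋯ āᵏ` times the symbol of `w` when every `nᵢ = 1`, and zero otherwise
(`symbolMap_mem_span_of_isWord`).

Since `M → gr A(M)` is onto (`symbolMap_surjective`) and words span `M` over `ℂ`, the symbols of `W`
generate `gr A(M)` over `gr A(V)`. The map `psi` is induced by `symbolMap` on `M / C₂(M)`, so these
symbols are exactly the elements `ψ(w + C₂(M))`. If `W` is finite, they form a finite generating
set. -/

namespace VOA

open VertexOperatorAlgebra

variable {V M : Type*} [AddCommGroup V] [Module ℂ V] [VertexOperatorAlgebra V]
  [AddCommGroup M] [Module ℂ M] [AdmissibleModule V M]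

/-! ### Symbols of modes -/

/-- The class `ā ∈ A(V)_p / A(V)_{p-1}` of `a ∈ V_p`, as an element of `gr A(V)`. -/
noncomputable def algSymbol {p : ℕ} {a : V} (ha : a ∈ wt p) : GrZhuAlgebra V :=
  DirectSum.of (Filt.Piece (algFil V)) p
    (Filt.toPiece (algFil V) p ⟨toZhuAlgebra V a, a, le_upTo V le_rfl ha, rfl⟩)

/-- A symbol may be computed from any element of `A(M)_n` with the same leading term. It is used
below with `y` zero, a `∗`-product, or an arbitrary element to be lifted. -/
theorem symbol_eq_toPiece {n : ℕ} {v : M} (hv : v ∈ AdmissibleModule.deg V n)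
    {y : modFil V M n} (h : toZhuModule V M v - y ∈ Filt.prev (modFil V M) n) :
    symbol V M n ⟨v, hv⟩ = Filt.toPiece (modFil V M) n y :=
  Filt.toPiece_eq (modFil V M) (x := ⟨toZhuModule V M v, v, le_upTo M le_rfl hv, rfl⟩) h

/-- `a_c v` is the leading term of `Res_z (1+z)^p z^c Y_M(a, z) v`. -/
theorem toZhuModule_mode_sub_res_mem_prev {p k n : ℕ} {c : ℤ} {a : V} {v : M} (ha : a ∈ wt p)
    (hv : v ∈ AdmissibleModule.deg V k) (h : (p : ℤ) + k - c - 1 = n) :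
    toZhuModule V M (mode V M c a v) - toZhuModule V M (res V M p c a v)
      ∈ Filt.prev (modFil V M) n := by
  -- Isolate the `j = 0` term, the only one of top degree; it has coefficient `C(p,0) = 1`.
  have h2 : res V M p c a v = ∑ j ∈ Finset.range p,
      (p.choose (j + 1) : ℂ) • mode V M (c + (j + 1 : ℕ)) a v + mode V M c a v := by
    rw [res, LinearMap.sum_apply, LinearMap.sum_apply, Finset.sum_range_succ']
    simp
  rw [← map_sub, h2, sub_add_cancel_right, map_neg, map_sum]
  refine neg_mem (Submodule.sum_mem _ fun j _ => ?_)
  rw [map_smul]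
  refine Submodule.smul_mem _ _ ?_
  have hm := AdmissibleModule.mode_mem p a ha (c + (j + 1 : ℕ)) k v hv
  -- The `j`-th term of the tail has degree `n - (j + 1)`. For `n = 0` the previous step is `⊥`, so
  -- the term must vanish, and it does because its degree is negative. For a successor the degree is
  -- small enough for the previous step.
  cases n with
  | zero =>
    have hneg : (p : ℤ) + k - (c + (j + 1 : ℕ)) - 1 = Int.negSucc j := by
      rw [Int.negSucc_eq]; push_cast at h ⊢; omega
    rw [hneg] at hm
    have hz : mode V M (c + (j + 1 : ℕ)) a v = 0 := (Submodule.mem_bot ℂ).1 hm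
    rw [hz, map_zero]
    exact zero_mem _
  | succ n =>
    exact ⟨_, intGrade_le_upTo M (by push_cast at h ⊢; omega) hm, rfl⟩

/-- The residue with the same leading term belongs to `O(M)` by `res_mem_O_of_le`, hence is zero in
`A(M)`. Covering every `c ≤ -2` disposes of all letters with `nᵢ ≥ 2` at once. -/
theorem symbolMap_mode_of_le {p : ℕ} {a : V} (ha : a ∈ wt p) {c : ℤ} (hc : c ≤ -2) (v : M) :
    symbolMap V M (mode V M c a v) = 0 := by
  refine grade_induction (AdmissibleModule.isInternal (V := V) (M := M))
    (p := fun v => symbolMap V M (mode V M c a v) = 0)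
    (by simp) (fun x y hx hy => by simp [hx, hy]) ?_ v
  intro k v hv
  -- The bound on `c` makes the degree of `a_c v` nonnegative, so it is a natural number.
  obtain ⟨n, hn⟩ := Int.eq_ofNat_of_zero_le (show 0 ≤ (p : ℤ) + k - c - 1 by omega)
  have hm : mode V M c a v ∈ AdmissibleModule.deg V n := mode_mem_deg ha hv hn
  have hz : toZhuModule V M (res V M p c a v) = 0 :=
    (Submodule.Quotient.mk_eq_zero _).2 (res_mem_O_of_le ha hc v)
  have h := toZhuModule_mode_sub_res_mem_prev ha hv hn
  rw [hz] at h
  rw [symbolMap_of_mem V M hm, symbol_eq_toPiece hm (y := 0) h, map_zero, map_zero]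

/-- The leading term of `a ∗ v` is `a_{-1} v`. Both sides are additive in `v`, so homogeneous `v`
suffices; the general case is needed because elements of `W` may be inhomogeneous. -/
theorem symbolMap_mode_neg_one {p : ℕ} {a : V} (ha : a ∈ wt p) (v : M) :
    symbolMap V M (mode V M (-1) a v) = algSymbol ha • symbolMap V M v := by
  refine grade_induction (AdmissibleModule.isInternal (V := V) (M := M))
    (p := fun v => symbolMap V M (mode V M (-1) a v) = algSymbol ha • symbolMap V M v)
    (by simp) (fun x y hx hy => by simp [hx, hy]) ?_ v
  intro k v hv
  have hn : (p : ℤ) + k - (-1) - 1 = (p + k : ℕ) := by push_cast; ring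
  have hm : mode V M (-1) a v ∈ AdmissibleModule.deg V (p + k) := mode_mem_deg ha hv hn
  have h := toZhuModule_mode_sub_res_mem_prev ha hv hn
  rw [← star_of_mem ha] at h
  rw [symbolMap_of_mem V M hm, symbolMap_of_mem V M hv, DirectSum.lof_eq_of, DirectSum.lof_eq_of,
    algSymbol, DirectSum.Gmodule.of_smul_of]
  congr 1
  -- The action on graded pieces is defined on representatives, so `ā` times the symbol of `v` is by
  -- definition the class of `a ∗ v`.
  exact symbol_eq_toPiece hm
    (y := ⟨toZhuModule V M (star V M a v), star V M a v,
      star_mem_upTo V M (le_upTo V le_rfl ha) (le_upTo M le_rfl hv), rfl⟩) h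

/-- Since `𝟏_{-1}` is the identity, the scalar `c` acts as the class of `c𝟏 ∈ V_0`. This makes a `gr
A(V)`-span absorb complex scalars. -/
theorem symbolMap_smul (c : ℂ) (v : M) :
    symbolMap V M (c • v)
      = algSymbol (Submodule.smul_mem _ c (vac_mem (V := V))) • symbolMap V M v := by
  rw [← symbolMap_mode_neg_one, (mode V M (-1)).map_smul, LinearMap.smul_apply, vac_mode_eq,
    if_pos rfl]

/-! ### Surjectivity of the symbol map -/

/-- Lift a class to `⨁_{i ≤ n} M(i)` and keep only the degree `n` component: the discarded ones map
into `A(M)_{n-1}`. -/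
theorem symbol_surjective (n : ℕ) : Function.Surjective (symbol V M n) := by
  rintro ⟨⟨_, x, hx, rfl⟩⟩
  have hsplit : ∃ v ∈ AdmissibleModule.deg (M := M) V n,
      toZhuModule V M v - toZhuModule V M x ∈ Filt.prev (modFil V M) n := by
    change x ∈ upTo _ n at hx
    cases n with
    | zero => exact ⟨x, by simpa [upTo] using hx, by simp⟩
    | succ n =>
      -- Here `⨁_{i ≤ n+1} M(i)` splits as `M(n+1)` plus `⨁_{i ≤ n} M(i)`.
      rw [upTo, Finset.range_add_one, Finset.iSup_insert, Submodule.mem_sup] at hx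
      obtain ⟨v, hv, u, hu, rfl⟩ := hx
      exact ⟨v, hv, by rw [← map_sub, sub_add_cancel_left, map_neg]; exact neg_mem ⟨u, hu, rfl⟩⟩
  obtain ⟨v, hv, h⟩ := hsplit
  exact ⟨⟨v, hv⟩, symbol_eq_toPiece hv h⟩

theorem symbolMap_surjective : Function.Surjective (symbolMap V M) := by
  intro y
  induction y using DirectSum.induction_on with
  | zero => exact ⟨0, map_zero _⟩
  | of n y =>
    obtain ⟨v, rfl⟩ := symbol_surjective (V := V) (M := M) n y
    exact ⟨v, symbolMap_of_mem V M v.2⟩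
  | add x y hx hy =>
    obtain ⟨u, rfl⟩ := hx
    obtain ⟨v, rfl⟩ := hy
    exact ⟨u + v, map_add _ _ _⟩

/-! ### Generation by the symbols of `W` -/

/-- Prepending a letter `a_{-1}` multiplies the symbol by `ā`; prepending `a_{-n}` with `n ≥ 2`
makes it zero. Either way the span is preserved. -/
theorem symbolMap_mem_span_of_isWord {W : Set M} {x : M} (hx : IsWord V M W x) :
    symbolMap V M x ∈ Submodule.span (GrZhuAlgebra V) (symbolMap V M '' W) := by
  induction hx with
  | base w hw => exact Submodule.subset_span ⟨w, hw, rfl⟩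
  | step p _ a ha n hn x _ ih =>
    rcases hn.eq_or_lt with rfl | hn
    · rw [Nat.cast_one, symbolMap_mode_neg_one ha]
      exact Submodule.smul_mem _ _ ih
    · rw [symbolMap_mode_of_le ha (by omega)]
      exact zero_mem _

theorem span_symbolMap_image_eq_top {W : Set M} (hW : StronglyGeneratedBy V M W) :
    Submodule.span (GrZhuAlgebra V) (symbolMap V M '' W) = ⊤ := by
  refine eq_top_iff.2 fun y _ => ?_
  obtain ⟨x, rfl⟩ := symbolMap_surjective y
  have hx : x ∈ Submodule.span ℂ {x : M | IsWord V M W x} := by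
    rw [show Submodule.span ℂ {x : M | IsWord V M W x} = ⊤ from hW]
    trivial
  -- The trivial hypothesis `symbolMap V M x ∈ ⊤` depends on `x` and is carried into the induction,
  -- hence the arguments `trivial` below.
  induction hx using Submodule.span_induction with
  | mem x hx => exact symbolMap_mem_span_of_isWord hx
  | zero => simp
  | add x y _ _ hx hy =>
    rw [map_add]
    exact add_mem (hx trivial) (hy trivial)
  | smul c x _ hx =>
    rw [symbolMap_smul]
    exact Submodule.smul_mem _ _ (hx trivial)

/-- `psi` composed with the quotient map is `symbolMap` by definition, so generation can be proved
on `M` itself. -/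
theorem psi_image_mkQ_image (W : Set M) :
    psi V M '' ((C2 V M).mkQ '' W) = symbolMap V M '' W := by
  rw [Set.image_image]
  rfl

end VOA

theorem proposition4p7 {V M : Type*} [AddCommGroup V] [Module ℂ V] [VertexOperatorAlgebra V]
    [AddCommGroup M] [Module ℂ M] [AdmissibleModule V M]
    (hV : VertexOperatorAlgebra.IsCFTType V) :
    (∀ W : Set M, VOA.StronglyGeneratedBy V M W →
      Submodule.span (VOA.GrZhuAlgebra V) (VOA.psi V M '' ((VOA.C2 V M).mkQ '' W)) = ⊤) ∧
    (VOA.StronglyFinitelyGenerated V M →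
      Module.Finite (VOA.GrZhuAlgebra V) (VOA.GrZhuModule V M)) := by
  refine ⟨fun W hW => ?_, fun ⟨W, hfin, hW⟩ => ?_⟩
  · rw [VOA.psi_image_mkQ_image]
    exact VOA.span_symbolMap_image_eq_top hW
  · exact ⟨Submodule.fg_def.2 ⟨_, hfin.image _, VOA.span_symbolMap_image_eq_top hW⟩⟩
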